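/- **Theorem (Lower bound of sparse Gaussian mean estimation).** There is a universal constant $c>0$ and, for every $\gamma\in(0,1)$, a constant $C=C(\gamma)>0$ such that the following holds for all integers $n\ge 1$, $d\ge 1$, $s\ge 1$ with $s\le d^{1-\gamma}$ and all $\epsilon\in[0,1]$. For $\mu\in\mathbb{R}^d$ let $\|\mu\|_0$ denote the number of non-zero coordinates of $\mu$, and for a probability distribution $Q$ on $\mathbb{R}^d$ let $\mathbb{P}_{\mu,Q}$ be the law of $n$ independent samples $x_1,\dots,x_n$ from the contaminated distribution $(1-\epsilon)N(\mu,I)+\epsilon Q$. Then $$\inf_{\widehat\mu}\ \sup_{\mu\in\mathbb{R}^d,\ \|\mu\|_0\le s}\ \sup_{Q}\ \mathbb{P}_{\mu,Q}\left[\|\widehat\mu-\mu\|_2^2\ \ge\ C\left(\frac{s\log d}{n}\vee\epsilon^2\right)\right]\ \ge\ c,$$ where the infimum is over all estimators, i.e. all measurable maps $\widehat\mu=\widehat\mu(x_1,\dots,x_n)$ from $(\mathbb{R}^d)^n$ to $\mathbb{R}^d$ (which may depend on $n,d,s,\epsilon$), and the second supremum is over all probability distributions $Q$ on $\mathbb{R}^d$.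 In particular, with $\gamma=1/2$, both constants are absolute whenever $s^2\le d$. -/

import Mathlib

open MeasureTheory ProbabilityTheory

/-- The `ℓ₀` "norm": the number of non-zero coordinates of a vector. -/
noncomputable def l0norm {d : ℕ} (v : EuclideanSpace ℝ (Fin d)) : ℕ :=
  {i : Fin d | v i ≠ 0}.ncard

/-- The contaminated law `(1 - ε) P + ε Q`. -/
noncomputable def contamination {d : ℕ} (ε : ℝ) (P Q : Measure (EuclideanSpace ℝ (Fin d))) :
    Measure (EuclideanSpace ℝ (Fin d)) :=
  ENNReal.ofReal (1 - ε) • P + ENNReal.ofReal ε • Q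

/-- The joint law of `n` independent samples from `(1 - ε) N(μ, I) + ε Q` in `ℝ^d`. -/
noncomputable def sampleLaw (n d : ℕ) (ε : ℝ) (μ : EuclideanSpace ℝ (Fin d))
    (Q : Measure (EuclideanSpace ℝ (Fin d))) : Measure (Fin n → EuclideanSpace ℝ (Fin d)) :=
  Measure.pi fun _ => contamination ε (multivariateGaussian μ 1) Q

/-- The minimax probability of a squared `ℓ₂` error of at least `r`, for estimating an `s`-sparse
Gaussian mean in `ℝ^d` from `n` samples that are contaminated at level `ε`: the infimum over all
estimators (measurable functions of the sample) of the supremum over the `s`-sparse means `μ` and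
over all contaminating probability distributions `Q`. -/
noncomputable def minimaxProb (n d s : ℕ) (ε r : ℝ) : ENNReal :=
  ⨅ (muHat : (Fin n → EuclideanSpace ℝ (Fin d)) → EuclideanSpace ℝ (Fin d))
    (_ : Measurable muHat),
  ⨆ (μ : EuclideanSpace ℝ (Fin d)) (_ : l0norm μ ≤ s)
    (Q : ProbabilityMeasure (EuclideanSpace ℝ (Fin d))),
    sampleLaw n d ε μ Q {x | r ≤ ‖muHat x - μ‖ ^ 2}

/-! The maximum of the two rates is attained by one of them, so each rate is bounded separately;
shrinking the error threshold only raises the probability (`minimaxProb_anti`).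

For `s log d / n` the adversary stays idle by taking `Q` equal to the clean Gaussian. Cut `s * m` of
the coordinates, `m = d / s`, into `s` blocks and put one spike of height `√(L/n)`, with `L` of
order `log d`, in each block. Every mean has likelihood ratio against `N(0, I)^n` of second moment
`exp (s L)`, so an event likely under it has null probability of order at least `exp (-s L)`. Few
words agree with a given one in half of the blocks, so few success events overlap, and too many
means would force too much null mass (`one_quarter_le_minimaxProb`,
`card_filter_agree_mul_sqrt_pow_le`). For bounded `d` a two-point bound of order `1/n` suffices.

For `ε ^ 2`, the laws `N(0, I)` and `N(θ, I)` with `‖θ‖ = ε / 2` are within total variation `ε`, so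
contamination can make them equal (`exists_contamination_eq`) and no estimator separates them,
whatever `n` is. -/

/-! ### Gaussian likelihood ratios and their second moments. -/

/-- The product of measures with densities has the product density. -/
theorem pi_withDensity_eq {ι : Type*} [Fintype ι] {X : ι → Type*} [∀ i, MeasurableSpace (X i)]
    (ν : ∀ i, Measure (X i)) [∀ i, IsProbabilityMeasure (ν i)] (f : ∀ i, X i → ENNReal)
    (hf : ∀ i, Measurable (f i)) [∀ i, SigmaFinite ((ν i).withDensity (f i))] :
    Measure.pi (fun i => (ν i).withDensity (f i)) =
      (Measure.pi ν).withDensity fun x => ∏ i, f i (x i) := by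
  refine Measure.pi_eq fun s hs => ?_
  have hm : MeasurableSet (Set.univ.pi s) := MeasurableSet.univ_pi hs
  have hind : iIndepFun (fun i (x : ∀ i, X i) => (s i).indicator (f i) (x i)) (Measure.pi ν) :=
    iIndepFun_pi (X := fun i => (s i).indicator (f i))
      fun i => ((hf i).indicator (hs i)).aemeasurable
  rw [withDensity_apply _ hm, ← lintegral_indicator hm]
  have h : (Set.univ.pi s).indicator (fun x : ∀ i, X i => ∏ i, f i (x i)) =
      fun x => ∏ i, (s i).indicator (f i) (x i) := by
    ext x
    by_cases hx : x ∈ Set.univ.pi s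
    · rw [Set.indicator_of_mem hx]
      exact Finset.prod_congr rfl fun i _ => (Set.indicator_of_mem (hx i trivial) _).symm
    · rw [Set.indicator_of_notMem hx]
      simp only [Set.mem_pi, Set.mem_univ, true_implies, not_forall] at hx
      obtain ⟨i, hi⟩ := hx
      exact (Finset.prod_eq_zero (Finset.mem_univ i) (Set.indicator_of_notMem hi _)).symm
  rw [h, lintegral_prod_eq_prod_lintegral_of_indepFun Finset.univ _ hind
    fun i => ((hf i).indicator (hs i)).comp (measurable_pi_apply i)]
  refine Finset.prod_congr rfl fun i _ => ?_
  rw [withDensity_apply _ (hs i), ← lintegral_indicator (hs i)]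
  exact (measurePreserving_eval ν i).lintegral_comp ((hf i).indicator (hs i))

/-- The density of `N(a, 1)` with respect to `N(0, 1)`. -/
noncomputable def gaussianShiftPDFReal (a t : ℝ) : ENNReal :=
  ENNReal.ofReal (Real.exp (a * t - a ^ 2 / 2))

theorem measurable_gaussianShiftPDFReal (a : ℝ) : Measurable (gaussianShiftPDFReal a) := by
  unfold gaussianShiftPDFReal
  fun_prop

theorem gaussianReal_eq_withDensity (a : ℝ) :
    gaussianReal a 1 = (gaussianReal 0 1).withDensity (gaussianShiftPDFReal a) := by
  rw [gaussianReal_of_var_ne_zero a one_ne_zero, gaussianReal_of_var_ne_zero 0 one_ne_zero,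
    ← withDensity_mul _ (measurable_gaussianPDF 0 1) (measurable_gaussianShiftPDFReal a)]
  congr 1
  ext t
  rw [Pi.mul_apply, gaussianPDF, gaussianPDF, gaussianShiftPDFReal,
    ← ENNReal.ofReal_mul (gaussianPDFReal_nonneg _ _ _), gaussianPDFReal, gaussianPDFReal,
    mul_assoc _ (Real.exp _) (Real.exp _), ← Real.exp_add]
  congr 3
  simp only [NNReal.coe_one]
  ring

/-- Both sides have the same characteristic function. -/
theorem multivariateGaussian_one_eq_map {d : ℕ} (θ : EuclideanSpace ℝ (Fin d)) :
    multivariateGaussian θ 1 =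
      (Measure.pi fun i => gaussianReal (θ i) 1).map (WithLp.toLp 2) := by
  apply Measure.ext_of_charFun (E := EuclideanSpace ℝ (Fin d))
  ext t
  rw [charFun_multivariateGaussian Matrix.PosSemidef.one]
  simp_rw [charFun_pi, charFun_gaussianReal, ← Complex.exp_sum]
  congr 1
  simp [Finset.sum_sub_distrib, PiLp.inner_apply, dotProduct, Finset.mul_sum, Finset.sum_div,
    mul_comm, sq]

/-- The density of `N(θ, I)` with respect to `N(0, I)`. -/
noncomputable def gaussianShiftPDF {d : ℕ} (θ x : EuclideanSpace ℝ (Fin d)) : ENNReal :=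
  ∏ i, gaussianShiftPDFReal (θ i) (x i)

theorem measurable_gaussianShiftPDF {d : ℕ} (θ : EuclideanSpace ℝ (Fin d)) :
    Measurable (gaussianShiftPDF θ) := by
  unfold gaussianShiftPDF gaussianShiftPDFReal
  fun_prop

theorem gaussianShiftPDF_ne_top {d : ℕ} (θ x : EuclideanSpace ℝ (Fin d)) :
    gaussianShiftPDF θ x ≠ ⊤ :=
  ENNReal.prod_ne_top fun _ _ => ENNReal.ofReal_ne_top

theorem multivariateGaussian_one_eq_withDensity {d : ℕ} (θ : EuclideanSpace ℝ (Fin d)) :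
    multivariateGaussian θ 1 = (multivariateGaussian 0 1).withDensity (gaussianShiftPDF θ) := by
  have hpi : (Measure.pi fun i => gaussianReal (θ i) 1) =
      (Measure.pi fun _ : Fin d => gaussianReal 0 1).withDensity
        fun x => ∏ i, gaussianShiftPDFReal (θ i) (x i) := by
    have (i : Fin d) :
        SigmaFinite ((gaussianReal 0 1).withDensity (gaussianShiftPDFReal (θ i))) := by
      rw [← gaussianReal_eq_withDensity]
      infer_instance
    rw [← pi_withDensity_eq (fun _ => gaussianReal 0 1) (fun i => gaussianShiftPDFReal (θ i))
      fun i => measurable_gaussianShiftPDFReal _]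
    simp_rw [← gaussianReal_eq_withDensity]
  have hm : Measurable (WithLp.toLp 2 : (Fin d → ℝ) → EuclideanSpace ℝ (Fin d)) := by fun_prop
  rw [multivariateGaussian_one_eq_map, multivariateGaussian_one_eq_map, hpi]
  ext s hs
  rw [Measure.map_apply hm hs, withDensity_apply _ (hm hs), withDensity_apply _ hs,
    setLIntegral_map hs (measurable_gaussianShiftPDF θ) hm]
  rfl

/-- Completing the square: since the density at `2 • θ` integrates to one, second moments follow
without computing an integral. -/
theorem gaussianShiftPDF_sq {d : ℕ} (θ x : EuclideanSpace ℝ (Fin d)) :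
    gaussianShiftPDF θ x ^ 2 =
      gaussianShiftPDF ((2 : ℝ) • θ) x * ENNReal.ofReal (Real.exp (‖θ‖ ^ 2)) := by
  rw [EuclideanSpace.real_norm_sq_eq, Real.exp_sum,
    ENNReal.ofReal_prod_of_nonneg fun _ _ => (Real.exp_pos _).le, gaussianShiftPDF,
    gaussianShiftPDF, ← Finset.prod_mul_distrib, ← Finset.prod_pow]
  refine Finset.prod_congr rfl fun i _ => ?_
  rw [gaussianShiftPDFReal, gaussianShiftPDFReal, ← ENNReal.ofReal_pow (Real.exp_pos _).le,
    ← ENNReal.ofReal_mul (Real.exp_pos _).le, ← Real.exp_add, ← Real.exp_nat_mul]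
  congr 2
  simp only [PiLp.smul_apply, smul_eq_mul]
  push_cast
  ring

theorem lintegral_gaussianShiftPDF {d : ℕ} (θ : EuclideanSpace ℝ (Fin d)) :
    ∫⁻ x, gaussianShiftPDF θ x ∂multivariateGaussian 0 1 = 1 := by
  rw [← setLIntegral_univ, ← withDensity_apply _ MeasurableSet.univ,
    ← multivariateGaussian_one_eq_withDensity, measure_univ]

theorem lintegral_gaussianShiftPDF_sq {d : ℕ} (θ : EuclideanSpace ℝ (Fin d)) :
    ∫⁻ x, gaussianShiftPDF θ x ^ 2 ∂multivariateGaussian 0 1 =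
      ENNReal.ofReal (Real.exp (‖θ‖ ^ 2)) := by
  simp_rw [gaussianShiftPDF_sq]
  rw [lintegral_mul_const _ (measurable_gaussianShiftPDF _), lintegral_gaussianShiftPDF, one_mul]

theorem pi_multivariateGaussian_eq_withDensity (n : ℕ) {d : ℕ} (θ : EuclideanSpace ℝ (Fin d)) :
    (Measure.pi fun _ : Fin n => multivariateGaussian θ 1) =
      (Measure.pi fun _ : Fin n => multivariateGaussian 0 1).withDensity
        fun x => ∏ k, gaussianShiftPDF θ (x k) := by
  have : SigmaFinite ((multivariateGaussian 0 1).withDensity (gaussianShiftPDF θ)) := by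
    rw [← multivariateGaussian_one_eq_withDensity]
    infer_instance
  rw [← pi_withDensity_eq (fun _ : Fin n => multivariateGaussian 0 1) (fun _ => gaussianShiftPDF θ)
      fun _ => measurable_gaussianShiftPDF _]
  simp_rw [← multivariateGaussian_one_eq_withDensity]

theorem measurable_prod_gaussianShiftPDF (n : ℕ) {d : ℕ} (θ : EuclideanSpace ℝ (Fin d)) :
    Measurable fun x : Fin n → EuclideanSpace ℝ (Fin d) => ∏ k, gaussianShiftPDF θ (x k) :=
  Finset.measurable_fun_prod _ fun k _ =>
    (measurable_gaussianShiftPDF θ).comp (measurable_pi_apply k)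

theorem lintegral_prod_gaussianShiftPDF_sq (n : ℕ) {d : ℕ} (θ : EuclideanSpace ℝ (Fin d)) :
    ∫⁻ x, (∏ k, gaussianShiftPDF θ (x k)) ^ 2
        ∂(Measure.pi fun _ : Fin n => multivariateGaussian 0 1) =
      ENNReal.ofReal (Real.exp (n * ‖θ‖ ^ 2)) := by
  simp_rw [← Finset.prod_pow, gaussianShiftPDF_sq, Finset.prod_mul_distrib]
  rw [lintegral_mul_const _ (measurable_prod_gaussianShiftPDF _ _), ← setLIntegral_univ,
    ← withDensity_apply _ MeasurableSet.univ, ← pi_multivariateGaussian_eq_withDensity,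
    measure_univ, one_mul, Finset.prod_const, Finset.card_univ, Fintype.card_fin,
    ← ENNReal.ofReal_pow (Real.exp_pos _).le, ← Real.exp_nat_mul]

theorem ENNReal.two_mul_mul_le_add_sq (a b : ENNReal) : 2 * a * b ≤ a ^ 2 + b ^ 2 := by
  rcases eq_or_ne a ⊤ with rfl | ha
  · simp
  rcases eq_or_ne b ⊤ with rfl | hb
  · simp
  lift a to NNReal using ha
  lift b to NNReal using hb
  exact_mod_cast two_mul_le_add_sq a b

/-- A change of measure inequality from the second moment of the likelihood ratio. -/
theorem two_mul_measureReal_pi_multivariateGaussian_le (n : ℕ) {d : ℕ}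
    (θ : EuclideanSpace ℝ (Fin d)) {t : ℝ} (ht : 0 ≤ t)
    {A : Set (Fin n → EuclideanSpace ℝ (Fin d))} (hA : MeasurableSet A) :
    2 * t * (Measure.pi fun _ : Fin n => multivariateGaussian θ 1).real A ≤
      t ^ 2 * (Measure.pi fun _ : Fin n => multivariateGaussian 0 1).real A +
        Real.exp (n * ‖θ‖ ^ 2) := by
  set ν := Measure.pi fun _ : Fin n => multivariateGaussian (0 : EuclideanSpace ℝ (Fin d)) 1
  set G : (Fin n → EuclideanSpace ℝ (Fin d)) → ENNReal := fun x => ∏ k, gaussianShiftPDF θ (x k)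
  have hG : Measurable G := measurable_prod_gaussianShiftPDF n θ
  have key : 2 * ENNReal.ofReal t * (Measure.pi fun _ : Fin n => multivariateGaussian θ 1) A ≤
      ENNReal.ofReal t ^ 2 * ν A + ENNReal.ofReal (Real.exp (n * ‖θ‖ ^ 2)) := by
    rw [pi_multivariateGaussian_eq_withDensity, withDensity_apply _ hA,
      ← lintegral_prod_gaussianShiftPDF_sq, ← lintegral_const_mul _ hG]
    -- Cauchy–Schwarz in its linearized form, with `t` left free to be optimized later.
    calc ∫⁻ x in A, 2 * ENNReal.ofReal t * G x ∂ν
        ≤ ∫⁻ x in A, (ENNReal.ofReal t ^ 2 + G x ^ 2) ∂ν :=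
          lintegral_mono fun x => ENNReal.two_mul_mul_le_add_sq _ _
      _ = ENNReal.ofReal t ^ 2 * ν A + ∫⁻ x in A, G x ^ 2 ∂ν := by
          rw [lintegral_add_left measurable_const, setLIntegral_const]
      _ ≤ _ := by
          exact add_le_add_right (setLIntegral_le_lintegral _ _) _
  have := ENNReal.toReal_mono (by finiteness) key
  rw [ENNReal.toReal_add (by finiteness) (by finiteness)] at this
  simpa [ENNReal.toReal_mul, ENNReal.toReal_ofReal ht, Real.exp_nonneg, measureReal_def] using this

/-! ### Contaminated laws and the minimax probability. -/

theorem contamination_self {d : ℕ} {ε : ℝ} (h0 : 0 ≤ ε) (h1 : ε ≤ 1)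
    (P : Measure (EuclideanSpace ℝ (Fin d))) : contamination ε P P = P := by
  rw [contamination, ← add_smul, ← ENNReal.ofReal_add (sub_nonneg.2 h1) h0, sub_add_cancel,
    ENNReal.ofReal_one, one_smul]

theorem isProbabilityMeasure_contamination {d : ℕ} {ε : ℝ} (h0 : 0 ≤ ε) (h1 : ε ≤ 1)
    (P Q : Measure (EuclideanSpace ℝ (Fin d))) [IsProbabilityMeasure P] [IsProbabilityMeasure Q] :
    IsProbabilityMeasure (contamination ε P Q) := by
  constructor
  simp [contamination, ← ENNReal.ofReal_add (sub_nonneg.2 h1) h0]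

theorem isProbabilityMeasure_sampleLaw {n d : ℕ} {ε : ℝ} (h0 : 0 ≤ ε) (h1 : ε ≤ 1)
    (μ : EuclideanSpace ℝ (Fin d)) (Q : Measure (EuclideanSpace ℝ (Fin d)))
    [IsProbabilityMeasure Q] : IsProbabilityMeasure (sampleLaw n d ε μ Q) := by
  have := isProbabilityMeasure_contamination h0 h1 (multivariateGaussian μ 1) Q
  rw [sampleLaw]
  infer_instance

theorem sampleLaw_le_iSup {n d s : ℕ} (ε r : ℝ)
    (muHat : (Fin n → EuclideanSpace ℝ (Fin d)) → EuclideanSpace ℝ (Fin d))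
    {μ : EuclideanSpace ℝ (Fin d)} (hμ : l0norm μ ≤ s)
    (Q : ProbabilityMeasure (EuclideanSpace ℝ (Fin d))) :
    sampleLaw n d ε μ Q {x | r ≤ ‖muHat x - μ‖ ^ 2} ≤
      ⨆ (μ : EuclideanSpace ℝ (Fin d)) (_ : l0norm μ ≤ s)
        (Q : ProbabilityMeasure (EuclideanSpace ℝ (Fin d))),
        sampleLaw n d ε μ Q {x | r ≤ ‖muHat x - μ‖ ^ 2} :=
  le_iSup₂_of_le μ hμ (le_iSup (fun Q : ProbabilityMeasure (EuclideanSpace ℝ (Fin d)) =>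
    sampleLaw n d ε μ Q {x | r ≤ ‖muHat x - μ‖ ^ 2}) Q)

theorem minimaxProb_anti {n d s : ℕ} {ε r r' : ℝ} (h : r' ≤ r) :
    minimaxProb n d s ε r ≤ minimaxProb n d s ε r' :=
  iInf₂_mono fun _ _ => iSup₂_mono fun _ _ => iSup_mono fun _ =>
    measure_mono fun _ hx => h.trans hx

/-! ### Reduction of estimation to testing. -/

/-- A Fano type bound: if the Gaussian means in a finite family are close to the origin, and few of
them lie in a common ball, then none of the estimators works for all of them. -/
theorem one_quarter_le_minimaxProb {n d s : ℕ} {ε r κ V : ℝ} (h0 : 0 ≤ ε) (h1 : ε ≤ 1)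
    {J : Type*} [Fintype J] [Nonempty J] (θ : J → EuclideanSpace ℝ (Fin d))
    (hs : ∀ j, l0norm (θ j) ≤ s) (hκ : ∀ j, n * ‖θ j‖ ^ 2 ≤ κ)
    (hV : ∀ j, ((Finset.univ.filter fun j' => ‖θ j - θ j'‖ ^ 2 < 4 * r).card : ℝ) ≤ V)
    (hM : Real.exp κ * V ≤ 9 / 16 * Fintype.card J) :
    ENNReal.ofReal (1 / 4) ≤ minimaxProb n d s ε r := by
  classical
  refine le_iInf₂ fun muHat hmu => ?_
  by_contra! hlt
  let P : J → Measure (Fin n → EuclideanSpace ℝ (Fin d)) := fun j =>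
    Measure.pi fun _ => multivariateGaussian (θ j) 1
  let ν : Measure (Fin n → EuclideanSpace ℝ (Fin d)) :=
    Measure.pi fun _ => multivariateGaussian 0 1
  let A : J → Set (Fin n → EuclideanSpace ℝ (Fin d)) := fun j => {x | ‖muHat x - θ j‖ ^ 2 < r}
  have hA (j : J) : MeasurableSet (A j) := measurableSet_lt (by fun_prop) measurable_const
  have hP (j : J) : 3 / 4 < (P j).real (A j) := by
    -- The contamination is chosen to be `N(θ j, I)` itself, so the sample is clean.
    have hj : P j (A j)ᶜ < ENNReal.ofReal (1 / 4) := by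
      refine lt_of_le_of_lt ?_ ((sampleLaw_le_iSup ε r muHat (hs j)
        ⟨multivariateGaussian (θ j) 1, inferInstance⟩).trans_lt hlt)
      simp only [sampleLaw, ProbabilityMeasure.coe_mk, contamination_self h0 h1]
      exact measure_mono fun x hx => not_lt.1 (show ¬ ‖muHat x - θ j‖ ^ 2 < r from hx)
    have hj' : (P j).real (A j)ᶜ < 1 / 4 := by
      rw [measureReal_def]
      exact (ENNReal.lt_ofReal_iff_toReal_lt (measure_ne_top _ _)).1 hj
    rw [probReal_compl_eq_one_sub (hA j)] at hj'
    linarith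
  have hsum : ∑ j, ν.real (A j) ≤ V := by
    have hind (j : J) : ν.real (A j) = ∫ x, (A j).indicator (fun _ => (1 : ℝ)) x ∂ν := by
      rw [integral_indicator (hA j)]
      simp
    have hint (j : J) : Integrable ((A j).indicator fun _ => (1 : ℝ)) ν :=
      (integrable_const 1).indicator (hA j)
    simp_rw [hind]
    rw [← integral_finsetSum _ fun j _ => hint j]
    -- If `x` lies in `A j` and `A j'`, both means are within `√r` of `muHat x`, so `j'` is among
    -- the neighbours counted by `V`.
    have hle (x : Fin n → EuclideanSpace ℝ (Fin d)) :
        ∑ j, (A j).indicator (fun _ => (1 : ℝ)) x ≤ V := by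
      simp only [Set.indicator_apply, Finset.sum_boole]
      rcases (Finset.univ.filter fun j => x ∈ A j).eq_empty_or_nonempty with he | ⟨j, hj⟩
      · rw [he]
        exact Nat.cast_zero.trans_le ((Nat.cast_nonneg _).trans (hV (Classical.arbitrary J)))
      · refine le_trans ?_ (hV j)
        gcongr with j' hj'
        intro hx'
        have hx : ‖muHat x - θ j‖ ^ 2 < r := (Finset.mem_filter.1 hj).2
        have hx' : ‖muHat x - θ j'‖ ^ 2 < r := hx'
        have htri : ‖θ j - θ j'‖ ≤ ‖muHat x - θ j‖ + ‖muHat x - θ j'‖ := by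
          rw [← norm_sub_rev (θ j)]
          exact norm_sub_le_norm_sub_add_norm_sub _ _ _
        nlinarith [norm_nonneg (θ j - θ j'), sq_nonneg (‖muHat x - θ j‖ - ‖muHat x - θ j'‖),
          norm_nonneg (muHat x - θ j), norm_nonneg (muHat x - θ j')]
    calc ∫ x, ∑ j, (A j).indicator (fun _ => (1 : ℝ)) x ∂ν
        ≤ ∫ _, V ∂ν := integral_mono (integrable_finsetSum _ fun j _ => hint j)
          (integrable_const V) hle
      _ = V := by simp
  set e := Real.exp κ with he
  have he0 : 0 < e := Real.exp_pos κ
  -- `t = 4/3 * e` is the optimal choice given success probability `3/4`; it yields `ν (A j) > 9 /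
  -- (16 e)`, whence the `9/16` in `hM`.
  have hj (j : J) : 2 * e < 16 / 9 * e ^ 2 * ν.real (A j) + e := by
    have h := two_mul_measureReal_pi_multivariateGaussian_le n (θ j) (t := 4 / 3 * e)
      (by positivity) (hA j)
    have h' : Real.exp (n * ‖θ j‖ ^ 2) ≤ e := Real.exp_le_exp.2 (hκ j)
    have h'' : 3 / 4 < (Measure.pi fun _ : Fin n => multivariateGaussian (θ j) 1).real (A j) := hP j
    change _ ≤ _ * ν.real (A j) + _ at h
    nlinarith
  have hlt : ∑ _j : J, 2 * e < ∑ j, (16 / 9 * e ^ 2 * ν.real (A j) + e) :=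
    Finset.sum_lt_sum_of_nonempty Finset.univ_nonempty fun j _ => hj j
  rw [Finset.sum_add_distrib, ← Finset.mul_sum _ _ (16 / 9 * e ^ 2), Finset.sum_const,
    Finset.sum_const, Finset.card_univ, nsmul_eq_mul, nsmul_eq_mul] at hlt
  nlinarith [mul_le_mul_of_nonneg_left hsum (sq_nonneg e), mul_le_mul_of_nonneg_left hM he0.le]

/-- If two sparse means give the same contaminated law, then no estimator separates them. -/
theorem one_half_le_minimaxProb_of_contamination_eq {n d s : ℕ} {ε r : ℝ} (h0 : 0 ≤ ε) (h1 : ε ≤ 1)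
    {θ₀ θ₁ : EuclideanSpace ℝ (Fin d)} (hs₀ : l0norm θ₀ ≤ s) (hs₁ : l0norm θ₁ ≤ s)
    (Q₀ Q₁ : ProbabilityMeasure (EuclideanSpace ℝ (Fin d)))
    (hQ : contamination ε (multivariateGaussian θ₀ 1) Q₀ =
      contamination ε (multivariateGaussian θ₁ 1) Q₁)
    (hr : 4 * r ≤ ‖θ₀ - θ₁‖ ^ 2) :
    ENNReal.ofReal (1 / 2) ≤ minimaxProb n d s ε r := by
  refine le_iInf₂ fun muHat _ => ?_
  by_contra! hlt
  have := isProbabilityMeasure_sampleLaw (n := n) h0 h1 θ₀ (Q₀ : Measure (EuclideanSpace ℝ (Fin d)))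
  -- By the triangle inequality one of the two errors always occurs, so under the common law their
  -- probabilities sum to at least one.
  have hsub : (Set.univ : Set (Fin n → EuclideanSpace ℝ (Fin d))) ⊆
      {x | r ≤ ‖muHat x - θ₀‖ ^ 2} ∪ {x | r ≤ ‖muHat x - θ₁‖ ^ 2} := by
    intro x _
    by_contra! hx
    simp only [Set.mem_union, Set.mem_ofPred_eq, not_or, not_le] at hx
    have htri : ‖θ₀ - θ₁‖ ≤ ‖muHat x - θ₀‖ + ‖muHat x - θ₁‖ := by
      rw [← norm_sub_rev θ₀]
      exact norm_sub_le_norm_sub_add_norm_sub _ _ _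
    nlinarith [norm_nonneg (θ₀ - θ₁), sq_nonneg (‖muHat x - θ₀‖ - ‖muHat x - θ₁‖),
      norm_nonneg (muHat x - θ₀), norm_nonneg (muHat x - θ₁)]
  have hle₀ : sampleLaw n d ε θ₀ Q₀ {x | r ≤ ‖muHat x - θ₀‖ ^ 2} < ENNReal.ofReal (1 / 2) :=
    lt_of_le_of_lt (sampleLaw_le_iSup ε r muHat hs₀ Q₀) hlt
  have hle₁ : sampleLaw n d ε θ₁ Q₁ {x | r ≤ ‖muHat x - θ₁‖ ^ 2} < ENNReal.ofReal (1 / 2) :=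
    lt_of_le_of_lt (sampleLaw_le_iSup ε r muHat hs₁ Q₁) hlt
  have heq : sampleLaw n d ε θ₁ Q₁ = sampleLaw n d ε θ₀ Q₀ := by
    rw [sampleLaw, sampleLaw, hQ]
  rw [heq] at hle₁
  have hlt := ((measure_mono hsub).trans (measure_union_le _ _)).trans_lt
    (ENNReal.add_lt_add hle₀ hle₁)
  rw [measure_univ, ← ENNReal.ofReal_add (by norm_num) (by norm_num)] at hlt
  norm_num at hlt

/-! ### Contamination that hides a small shift of the mean. -/

/-- Half of the `L¹` distance of `N(0, I)` and `N(θ, I)` is at most `‖θ‖`, up to a constant. -/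
theorem lintegral_gaussianShiftPDF_sub_one_le {d : ℕ} {θ : EuclideanSpace ℝ (Fin d)} {ε : ℝ}
    (hε : 0 < ε) (h1 : ε ≤ 1) (hθ : ‖θ‖ ≤ ε / 2) :
    ∫⁻ x, (gaussianShiftPDF θ x - 1) ∂multivariateGaussian 0 1 ≤ ENNReal.ofReal ε := by
  set P : Measure (EuclideanSpace ℝ (Fin d)) := multivariateGaussian 0 1
  set g := gaussianShiftPDF θ
  have hg : Measurable g := measurable_gaussianShiftPDF θ
  -- Subtraction is truncated, so `g x - 1` is the positive part; its square is at most `(g x - 1) ^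
  -- 2` over the reals, written here without negative terms.
  have hpt (x : EuclideanSpace ℝ (Fin d)) : (g x - 1) ^ 2 + 2 * g x ≤ g x ^ 2 + 1 := by
    have hx : g x ≠ ⊤ := gaussianShiftPDF_ne_top θ x
    lift g x to NNReal using hx with y
    norm_cast
    rcases le_total y 1 with hy | hy
    · rw [tsub_eq_zero_of_le hy]
      have := two_mul_le_add_sq y 1
      simpa using this
    · obtain ⟨z, rfl⟩ := exists_add_of_le hy
      rw [add_tsub_cancel_left]
      apply le_of_eq
      ring
  have hsq : ∫⁻ x, (g x - 1) ^ 2 ∂P ≤ ENNReal.ofReal (Real.exp (‖θ‖ ^ 2) - 1) := by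
    have h := lintegral_mono (μ := P) hpt
    rw [lintegral_add_right _ (hg.const_mul 2), lintegral_const_mul _ hg,
      lintegral_gaussianShiftPDF, lintegral_add_right _ measurable_const,
      lintegral_gaussianShiftPDF_sq, lintegral_one, measure_univ, mul_one] at h
    have h2 (y : ENNReal) : y + 2 = y + 1 + 1 := by rw [add_assoc, one_add_one_eq_two]
    rw [h2] at h
    have h := ENNReal.le_of_add_le_add_right ENNReal.one_ne_top h
    rw [ENNReal.ofReal_sub _ zero_le_one, ENNReal.ofReal_one]
    exact ENNReal.le_sub_of_add_le_right ENNReal.one_ne_top h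
  have hexp : Real.exp (‖θ‖ ^ 2) - 1 ≤ ε ^ 2 / 2 := by
    have hx0 := sq_nonneg ‖θ‖
    have hx : ‖θ‖ ^ 2 ≤ ε ^ 2 / 4 := by nlinarith [norm_nonneg θ]
    have hx1 : ‖θ‖ ^ 2 ≤ 1 / 4 := by nlinarith
    have h := Real.abs_exp_sub_one_le (x := ‖θ‖ ^ 2) (by rw [abs_of_nonneg hx0]; linarith)
    rw [abs_of_nonneg hx0] at h
    linarith [le_abs_self (Real.exp (‖θ‖ ^ 2) - 1)]
  -- Cauchy–Schwarz again as `2ab ≤ a² + b²`, with `a = ε` because the second moment is at most `ε ^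
  -- 2`.
  have hfin : 2 * ENNReal.ofReal ε * ∫⁻ x, (g x - 1) ∂P ≤
      2 * ENNReal.ofReal ε * ENNReal.ofReal ε := by
    rw [← lintegral_const_mul _ (hg.sub_const 1)]
    calc ∫⁻ x, 2 * ENNReal.ofReal ε * (g x - 1) ∂P
        ≤ ∫⁻ x, (ENNReal.ofReal ε ^ 2 + (g x - 1) ^ 2) ∂P :=
          lintegral_mono fun x => ENNReal.two_mul_mul_le_add_sq _ _
      _ ≤ ENNReal.ofReal ε ^ 2 + ENNReal.ofReal ε ^ 2 := by
          rw [lintegral_add_left measurable_const, lintegral_const, measure_univ, mul_one]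
          gcongr
          refine hsq.trans ?_
          rw [← ENNReal.ofReal_pow hε.le]
          exact ENNReal.ofReal_le_ofReal (by nlinarith)
      _ = _ := by ring
  have hpos : 2 * ENNReal.ofReal ε ≠ 0 := by simp [hε]
  exact (ENNReal.mul_le_mul_iff_right hpos (by finiteness)).1 hfin

/-- The positive and negative parts `U`, `W` of `N(θ, I) - N(0, I)` satisfy `P + U = N(θ, I) + W`,
so adding the missing part to each side equalizes the laws. Scaled by `1 - ε` these parts have mass
at most `ε`; the unused budget is spent on `P` on both sides. -/
theorem exists_contamination_eq {d : ℕ} {θ : EuclideanSpace ℝ (Fin d)} {ε : ℝ}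
    (hε : 0 < ε) (h1 : ε ≤ 1) (hθ : ‖θ‖ ≤ ε / 2) :
    ∃ Q₀ Q₁ : ProbabilityMeasure (EuclideanSpace ℝ (Fin d)),
      contamination ε (multivariateGaussian 0 1) Q₀ =
        contamination ε (multivariateGaussian θ 1) Q₁ := by
  set P : Measure (EuclideanSpace ℝ (Fin d)) := multivariateGaussian 0 1
  set g := gaussianShiftPDF θ
  have hg : Measurable g := measurable_gaussianShiftPDF θ
  set U := P.withDensity fun x => g x - 1
  set W := P.withDensity fun x => 1 - g x
  have hUW : P + U = multivariateGaussian θ 1 + W := by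
    have hP : P = P.withDensity fun _ => 1 := withDensity_one.symm
    rw [multivariateGaussian_one_eq_withDensity, ← withDensity_add_left hg]
    nth_rewrite 1 [hP]
    rw [← withDensity_add_left measurable_const]
    congr 1
    ext x
    calc 1 + (g x - 1) = max 1 (g x) := add_tsub_eq_max
      _ = max (g x) 1 := max_comm _ _
      _ = g x + (1 - g x) := add_tsub_eq_max.symm
  have hU : U Set.univ ≤ ENNReal.ofReal ε := by
    rw [withDensity_apply _ MeasurableSet.univ, setLIntegral_univ]
    exact lintegral_gaussianShiftPDF_sub_one_le hε h1 hθ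
  have hmass : W Set.univ = U Set.univ := by
    have h := congrArg (fun m : Measure (EuclideanSpace ℝ (Fin d)) => m Set.univ) hUW
    simp only [Measure.add_apply, measure_univ] at h
    exact ((ENNReal.add_right_inj ENNReal.one_ne_top).1 h).symm
  set α := ENNReal.ofReal (1 - ε)
  set β := ENNReal.ofReal ε
  have hβ0 : β ≠ 0 := by simp [β, hε]
  have hβt : β ≠ ⊤ := ENNReal.ofReal_ne_top
  have hα : α ≤ 1 := ENNReal.ofReal_le_one.2 (by linarith)
  have hle : α * U Set.univ ≤ β := (mul_le_of_le_one_left' hα).trans hU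
  have hprob (D : Measure (EuclideanSpace ℝ (Fin d))) (hD : D Set.univ = U Set.univ) :
      IsProbabilityMeasure (β⁻¹ • (α • D + (β - α * U Set.univ) • P)) := by
    constructor
    simp only [Measure.smul_apply, Measure.add_apply, smul_eq_mul, hD, measure_univ, mul_one]
    rw [add_tsub_cancel_of_le hle, ENNReal.inv_mul_cancel hβ0 hβt]
  refine ⟨⟨_, hprob U rfl⟩, ⟨_, hprob W hmass⟩, ?_⟩
  simp only [ProbabilityMeasure.coe_mk, contamination]
  rw [smul_smul, smul_smul, ENNReal.mul_inv_cancel hβ0 hβt, one_smul, one_smul, ← add_assoc,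
    ← add_assoc, ← smul_add, ← smul_add, hUW]

/-! ### Families of sparse means. -/

/-- The vector that equals `a` on `S` and vanishes elsewhere. -/
noncomputable def spike {d : ℕ} (S : Finset (Fin d)) (a : ℝ) : EuclideanSpace ℝ (Fin d) :=
  WithLp.toLp 2 fun i => if i ∈ S then a else 0

theorem l0norm_spike_le {d : ℕ} (S : Finset (Fin d)) (a : ℝ) : l0norm (spike S a) ≤ S.card := by
  rw [l0norm, ← Set.ncard_coe_finset]
  refine Set.ncard_le_ncard (fun i hi => ?_) S.finite_toSet
  by_contra h
  exact hi (if_neg h)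

theorem norm_spike_sq {d : ℕ} (S : Finset (Fin d)) (a : ℝ) :
    ‖spike S a‖ ^ 2 = S.card * a ^ 2 := by
  simp [EuclideanSpace.real_norm_sq_eq, spike, ite_pow]

theorem card_sdiff_mul_sq_le_norm_spike_sub_sq {d : ℕ} (S T : Finset (Fin d)) (a : ℝ) :
    (S \ T).card * a ^ 2 ≤ ‖spike S a - spike T a‖ ^ 2 := by
  rw [EuclideanSpace.real_norm_sq_eq, ← nsmul_eq_mul, ← Finset.sum_const]
  refine (Finset.sum_le_sum fun i hi => ?_).trans
    (Finset.sum_le_univ_sum_of_nonneg fun i => sq_nonneg _)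
  rw [Finset.mem_sdiff] at hi
  simp [spike, hi.1, hi.2]

/-- The parametric lower bound, from the two means `0` and `a e₁`. -/
theorem one_quarter_le_minimaxProb_parametric {n d s : ℕ} {ε : ℝ} (hn : 1 ≤ n) (hd : 1 ≤ d)
    (hs : 1 ≤ s) (h0 : 0 ≤ ε) (h1 : ε ≤ 1) :
    ENNReal.ofReal (1 / 4) ≤ minimaxProb n d s ε (1 / (40 * n)) := by
  have hn' : (0 : ℝ) < n := by exact_mod_cast hn
  set a := Real.sqrt (1 / (10 * n))
  have ha2 : a ^ 2 = 1 / (10 * n) := Real.sq_sqrt (by positivity)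
  let S : Bool → Finset (Fin d) := fun b => if b then {⟨0, hd⟩} else ∅
  have hcard (b : Bool) : (S b).card ≤ 1 := by cases b <;> simp [S]
  refine one_quarter_le_minimaxProb (κ := 1 / 10) (V := 1) h0 h1 (fun b => spike (S b) a)
    (fun b => (l0norm_spike_le _ _).trans ((hcard b).trans hs)) (fun b => ?_) (fun b => ?_) ?_
  · rw [norm_spike_sq, ha2]
    have : ((S b).card : ℝ) ≤ 1 := by exact_mod_cast hcard b
    calc (n : ℝ) * ((S b).card * (1 / (10 * n))) = (S b).card * (1 / 10) := by field_simp
      _ ≤ 1 / 10 := by linarith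
  · have hdist : a ^ 2 ≤ ‖spike (S true) a - spike (S false) a‖ ^ 2 := by
      simpa [S] using card_sdiff_mul_sq_le_norm_spike_sub_sq (S true) (S false) a
    have h4 : 4 * (1 / (40 * (n : ℝ))) = a ^ 2 := by
      rw [ha2]
      field_simp
      norm_num
    have hsub : (Finset.univ.filter fun b' =>
        ‖spike (S b) a - spike (S b') a‖ ^ 2 < 4 * (1 / (40 * (n : ℝ)))) ⊆ {b} := by
      intro b' hb'
      rw [Finset.mem_filter, h4] at hb'
      rw [Finset.mem_singleton]
      by_contra hne
      refine absurd hb'.2 (not_lt.2 ?_)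
      cases b <;> cases b'
      · exact absurd rfl hne
      · rwa [norm_sub_rev]
      · exact hdist
      · exact absurd rfl hne
    exact_mod_cast Finset.card_le_card hsub
  -- With two means and `V = 1` the requirement is `exp (1/10) ≤ 9/8`.
  · have h := Real.abs_exp_sub_one_sub_id_le (x := 1 / 10) (by norm_num [abs_of_pos])
    rw [Fintype.card_bool]
    have := (abs_le.1 h).2
    norm_num at this ⊢
    linarith

/-- The number of words over an alphabet of size `m` that agree with a given word in at least half
of the positions. -/
theorem card_filter_agree_mul_sqrt_pow_le {s m : ℕ} (j : Fin s → Fin m) :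
    ((Finset.univ.filter fun j' : Fin s → Fin m =>
        s ≤ 2 * (Finset.univ.filter fun k => j k = j' k).card).card : ℝ) * Real.sqrt m ^ s ≤
      (2 * m) ^ s := by
  -- Markov's inequality for the weight `m ^ (number of agreements)`: it is at least `√m ^ s` on the
  -- counted words, and its total factorizes over positions into factors `m + (m - 1) ≤ 2 * m`.
  have hprod (j' : Fin s → Fin m) :
      ∏ k, (if j k = j' k then (m : ℝ) else 1) =
        (m : ℝ) ^ (Finset.univ.filter fun k => j k = j' k).card := by
    rw [Finset.prod_ite, Finset.prod_const, Finset.prod_const_one, mul_one]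
  have htotal : ∑ j' : Fin s → Fin m, ∏ k, (if j k = j' k then (m : ℝ) else 1) ≤ (2 * m) ^ s := by
    rw [← Fintype.piFinset_univ,
      Finset.sum_prod_piFinset Finset.univ fun k l => if j k = l then (m : ℝ) else 1]
    calc ∏ k : Fin s, ∑ l : Fin m, (if j k = l then (m : ℝ) else 1)
        ≤ ∏ _k : Fin s, (2 * m : ℝ) := by
          refine Finset.prod_le_prod (fun k _ => Finset.sum_nonneg fun l _ => by positivity)
            fun k _ => ?_
          calc ∑ l : Fin m, (if j k = l then (m : ℝ) else 1)
              ≤ ∑ l : Fin m, ((if j k = l then (m : ℝ) else 0) + 1) := by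
                refine Finset.sum_le_sum fun l _ => ?_
                split_ifs <;> simp
            _ = 2 * m := by
                rw [Finset.sum_add_distrib]
                simp
                ring
      _ = (2 * m) ^ s := by simp
  refine le_trans ?_ htotal
  rw [← nsmul_eq_mul, ← Finset.sum_const]
  refine (Finset.sum_le_sum fun j' hj' => ?_).trans
    (Finset.sum_le_univ_sum_of_nonneg fun j' => Finset.prod_nonneg fun k _ => by positivity)
  rw [hprod]
  rcases Nat.eq_zero_or_pos s with rfl | hs
  · simp
  have hm : (1 : ℝ) ≤ m := by exact_mod_cast (j ⟨0, hs⟩).pos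
  calc Real.sqrt m ^ s ≤ Real.sqrt m ^ (2 * (Finset.univ.filter fun k => j k = j' k).card) :=
        pow_le_pow_right₀ (Real.one_le_sqrt.2 hm) (Finset.mem_filter.1 hj').2
    _ = _ := by rw [pow_mul, Real.sq_sqrt (by positivity)]

/-- The bound from the means with one spike of size `√(L / n)` in each of `s` blocks of length `m`. -/
theorem one_quarter_le_minimaxProb_blocks {n d s m : ℕ} {ε L : ℝ} (hn : 1 ≤ n) (hs : 1 ≤ s)
    (hm : 1 ≤ m) (hsm : s * m ≤ d) (h0 : 0 ≤ ε) (h1 : ε ≤ 1) (hL : 0 < L)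
    (hLm : 4 * Real.exp L ≤ Real.sqrt m) :
    ENNReal.ofReal (1 / 4) ≤ minimaxProb n d s ε (s * L / (8 * n)) := by
  have hn' : (0 : ℝ) < n := by exact_mod_cast hn
  have hm' : (0 : ℝ) < m := by exact_mod_cast hm
  set a := Real.sqrt (L / n)
  have ha2 : a ^ 2 = L / n := Real.sq_sqrt (by positivity)
  have ha0 : 0 < a ^ 2 := by rw [ha2]; positivity
  let ι : Fin s × Fin m → Fin d := fun p => Fin.castLE hsm (finProdFinEquiv p)
  have hι : Function.Injective ι :=
    (Fin.castLE_injective hsm).comp finProdFinEquiv.injective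
  let S : (Fin s → Fin m) → Finset (Fin d) := fun j => Finset.univ.image fun k => ι (k, j k)
  have hinj (j : Fin s → Fin m) : Function.Injective fun k => ι (k, j k) :=
    fun k k' h => congrArg Prod.fst (hι h)
  have hcard (j : Fin s → Fin m) : (S j).card = s := by
    rw [Finset.card_image_of_injective _ (hinj j), Finset.card_univ, Fintype.card_fin]
  have hdiff (j j' : Fin s → Fin m) :
      (Finset.univ.filter fun k => ¬ j k = j' k).card ≤ (S j \ S j').card := by
    rw [← Finset.card_image_of_injective _ (hinj j)]
    refine Finset.card_le_card fun i hi => ?_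
    obtain ⟨k, hk, rfl⟩ := Finset.mem_image.1 hi
    rw [Finset.mem_sdiff]
    refine ⟨Finset.mem_image_of_mem _ (Finset.mem_univ k), fun hmem => ?_⟩
    obtain ⟨k', -, hk'⟩ := Finset.mem_image.1 hmem
    have h := Prod.ext_iff.1 (hι hk')
    obtain rfl := h.1
    exact (Finset.mem_filter.1 hk).2 h.2.symm
  have : Nonempty (Fin m) := ⟨⟨0, hm⟩⟩
  -- `V` is the word count bound `(2 * m) ^ s / √m ^ s`. Words differing in at least half of the
  -- blocks are at squared distance at least `s * a ^ 2 / 2 = 4 * r`.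
  refine one_quarter_le_minimaxProb (κ := s * L) (V := (2 * Real.sqrt m) ^ s) h0 h1
    (fun j => spike (S j) a) (fun j => (l0norm_spike_le _ _).trans (hcard j).le)
    (fun j => ?_) (fun j => ?_) ?_
  · rw [norm_spike_sq, ha2, hcard]
    apply le_of_eq
    field_simp
  · have hsq : 0 < Real.sqrt m ^ s := by positivity
    rw [← mul_le_mul_iff_left₀ hsq, ← mul_pow, mul_assoc, Real.mul_self_sqrt hm'.le]
    refine le_trans ?_ (card_filter_agree_mul_sqrt_pow_le j)
    gcongr with j' _
    intro hj'
    have h4 : 4 * (s * L / (8 * (n : ℝ))) = s * a ^ 2 / 2 := by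
      rw [ha2]
      field_simp
      norm_num
    rw [h4] at hj'
    have hlt := (card_sdiff_mul_sq_le_norm_spike_sub_sq (S j) (S j') a).trans_lt hj'
    have hlt' : ((S j \ S j').card : ℝ) * 2 < s := by
      by_contra! h
      nlinarith
    have hlt'' : (S j \ S j').card * 2 < s := by exact_mod_cast hlt'
    have hsplit := Finset.card_filter_add_card_filter_not (s := Finset.univ) fun k => j k = j' k
    rw [Finset.card_univ, Fintype.card_fin] at hsplit
    have := hdiff j j'
    omega
  · have hexp : Real.exp (s * L) = Real.exp L ^ s := Real.exp_nat_mul L s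
    rw [hexp, ← mul_pow, Fintype.card_fun, Fintype.card_fin, Fintype.card_fin]
    have hbase : Real.exp L * (2 * Real.sqrt m) ≤ m / 2 := by
      nlinarith [Real.mul_self_sqrt hm'.le, Real.sqrt_nonneg (m : ℝ)]
    have hhalf : (1 / 2 : ℝ) ^ s ≤ 1 / 2 := by
      simpa using pow_le_pow_of_le_one (by norm_num : (0 : ℝ) ≤ 1 / 2) (by norm_num) hs
    calc (Real.exp L * (2 * Real.sqrt m)) ^ s ≤ (m / 2 : ℝ) ^ s := by gcongr
      _ = (1 / 2 : ℝ) ^ s * m ^ s := by rw [← mul_pow]; ring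
      _ ≤ 9 / 16 * m ^ s := by
          gcongr
          linarith
      _ = _ := by push_cast; rfl

/-- The part of the lower bound that is due to the contamination. -/
theorem one_half_le_minimaxProb_contamination {n d s : ℕ} {ε : ℝ} (hd : 1 ≤ d) (hs : 1 ≤ s)
    (h0 : 0 < ε) (h1 : ε ≤ 1) :
    ENNReal.ofReal (1 / 2) ≤ minimaxProb n d s ε (ε ^ 2 / 16) := by
  set θ : EuclideanSpace ℝ (Fin d) := spike {⟨0, hd⟩} (ε / 2)
  have hθ : ‖θ‖ ^ 2 = (ε / 2) ^ 2 := by simp [θ, norm_spike_sq]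
  obtain ⟨Q₀, Q₁, hQ⟩ := exists_contamination_eq (θ := θ) h0 h1
    ((sq_le_sq₀ (norm_nonneg _) (by positivity)).1 hθ.le)
  refine one_half_le_minimaxProb_of_contamination_eq h0.le h1 ?_ ?_ Q₀ Q₁ hQ ?_
  · simp [l0norm]
  · exact (l0norm_spike_le _ _).trans (by simpa using hs)
  · rw [zero_sub, norm_neg, hθ]
    apply le_of_eq
    ring

/-! ### Choice of constants and combination of the rates. -/

/-- The part of the lower bound that is due to the choice of the sparsity pattern. -/
theorem exists_one_quarter_le_minimaxProb_sparse {γ : ℝ} (hγ : 0 < γ) :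
    ∃ C : ℝ, 0 < C ∧ ∀ (n d s : ℕ) (ε : ℝ), 1 ≤ n → 1 ≤ d → 1 ≤ s →
      (s : ℝ) ≤ (d : ℝ) ^ (1 - γ) → 0 ≤ ε → ε ≤ 1 →
      ENNReal.ofReal (1 / 4) ≤ minimaxProb n d s ε (C * (s * Real.log d / n)) := by
  set D : ℝ := 1024 ^ (1 / γ)
  have hD : 0 < D := by positivity
  -- `γ / 32` is the `1/8` of the block bound times `L / log d = γ / 4`. The other constant serves
  -- `d ≤ D`, where `s * log d ≤ D ^ 2`.
  refine ⟨min (γ / 32) (1 / (40 * D ^ 2)), by positivity, fun n d s ε hn hd hs hsd h0 h1 => ?_⟩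
  have hn' : (0 : ℝ) < n := by exact_mod_cast hn
  have hd' : (1 : ℝ) ≤ d := by exact_mod_cast hd
  have hs' : (1 : ℝ) ≤ s := by exact_mod_cast hs
  have hd0 : (0 : ℝ) < d := by linarith
  have hlog : 0 ≤ Real.log d := Real.log_nonneg hd'
  have hsd1 : (s : ℝ) * (d : ℝ) ^ γ ≤ d := by
    calc (s : ℝ) * (d : ℝ) ^ γ ≤ (d : ℝ) ^ (1 - γ) * (d : ℝ) ^ γ := by gcongr
      _ = d := by rw [← Real.rpow_add hd0, sub_add_cancel, Real.rpow_one]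
  have hdγ : 1 ≤ (d : ℝ) ^ γ := Real.one_le_rpow hd' hγ.le
  rcases le_total (1024 : ℝ) ((d : ℝ) ^ γ) with hbig | hsmall
  · set m := d / s with hm
    have hlt : (d : ℝ) < s * (m + 1) := by
      exact_mod_cast Nat.lt_mul_div_succ d (by omega : 0 < s)
    have hγm : (d : ℝ) ^ γ < m + 1 := by
      by_contra! h
      nlinarith
    have hm1 : 1 ≤ m := by
      have : (0 : ℝ) < m := by linarith
      exact_mod_cast this
    have hm2 : (d : ℝ) ^ γ ≤ 2 * m := by linarith
    have hL : 0 < γ / 4 * Real.log d := by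
      have : 1 < (d : ℝ) := by
        by_contra! h
        have : (d : ℝ) = 1 := le_antisymm h hd'
        rw [this, Real.one_rpow] at hbig
        norm_num at hbig
      have := Real.log_pos this
      positivity
    have hexp : Real.exp (γ / 4 * Real.log d) ^ 4 = (d : ℝ) ^ γ := by
      rw [← Real.exp_nat_mul, Real.rpow_def_of_pos hd0]
      congr 1
      push_cast
      ring
    have hLm : 4 * Real.exp (γ / 4 * Real.log d) ≤ Real.sqrt m := by
      apply Real.le_sqrt_of_sq_le
      -- With `y = d ^ (γ / 2)` the claim is `16 * y ≤ m`, which follows from `y ^ 2 ≤ 2 * m` once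
      -- `y ≥ 32`; hence the threshold `1024 = 32 ^ 2`.
      set y := Real.exp (γ / 4 * Real.log d) ^ 2 with hy
      have hy2 : y ^ 2 = (d : ℝ) ^ γ := by rw [hy, ← pow_mul, hexp]
      have hy32 : 32 ≤ y := by
        refine le_of_sq_le_sq ?_ (sq_nonneg _)
        rw [hy2]
        linarith
      nlinarith
    refine (one_quarter_le_minimaxProb_blocks hn hs hm1 (Nat.mul_div_le d s) h0 h1 hL hLm).trans
      (minimaxProb_anti ?_)
    calc _ ≤ γ / 32 * (s * Real.log d / n) := by
          gcongr
          exact min_le_left _ _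
      _ = _ := by
          ring
  · refine (one_quarter_le_minimaxProb_parametric hn hd hs h0 h1).trans (minimaxProb_anti ?_)
    have hdD : (d : ℝ) ≤ D := by
      calc (d : ℝ) = ((d : ℝ) ^ γ) ^ (1 / γ) := by
            rw [← Real.rpow_mul hd0.le, mul_one_div_cancel hγ.ne', Real.rpow_one]
        _ ≤ D := Real.rpow_le_rpow (by positivity) hsmall (by positivity)
    have hsD : (s : ℝ) ≤ D := by nlinarith
    have hlogD : Real.log d ≤ D := (Real.log_le_self hd0.le).trans hdD
    calc _ ≤ 1 / (40 * D ^ 2) * (D * D / n) := by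
          gcongr
          exact min_le_right _ _
      _ = _ := by field_simp

theorem mainTheorem5 :
    ∃ c : ℝ, 0 < c ∧ ∀ γ : ℝ, 0 < γ → γ < 1 → ∃ C : ℝ, 0 < C ∧
      ∀ (n d s : ℕ) (ε : ℝ), 1 ≤ n → 1 ≤ s → (s : ℝ) ≤ (d : ℝ) ^ (1 - γ) → 0 ≤ ε → ε ≤ 1 →
        ENNReal.ofReal c ≤
          minimaxProb n d s ε (C * max ((s : ℝ) * Real.log (d : ℝ) / (n : ℝ)) (ε ^ 2)) := by
  refine ⟨1 / 4, by norm_num, fun γ hγ0 hγ1 => ?_⟩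
  obtain ⟨C, hC, hsparse⟩ := exists_one_quarter_le_minimaxProb_sparse hγ0
  refine ⟨min C (1 / 16), by positivity, fun n d s ε hn hs hsd h0 h1 => ?_⟩
  -- For `d = 0` the sparsity bound reads `s ≤ 0 ^ (1 - γ) = 0`, as `γ < 1`.
  have hd : 1 ≤ d := by
    rw [Nat.one_le_iff_ne_zero]
    rintro rfl
    rw [Nat.cast_zero, Real.zero_rpow (by linarith)] at hsd
    have : (1 : ℝ) ≤ s := by exact_mod_cast hs
    linarith
  have hrate : 0 ≤ (s : ℝ) * Real.log d / n := by
    have := Real.log_natCast_nonneg d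
    positivity
  rcases le_total (ε ^ 2) ((s : ℝ) * Real.log d / n) with h | h
  · rw [max_eq_left h]
    refine (hsparse n d s ε hn hd hs hsd h0 h1).trans (minimaxProb_anti ?_)
    gcongr
    exact min_le_left _ _
  · rw [max_eq_right h]
    -- At `ε = 0` the threshold is zero and the contamination bound is unavailable, but the sparse
    -- bound already has a nonnegative threshold.
    rcases h0.eq_or_lt with rfl | hpos
    · refine (hsparse n d s 0 hn hd hs hsd le_rfl h1).trans (minimaxProb_anti ?_)
      rw [zero_pow two_ne_zero, mul_zero]
      positivity
    · refine ((ENNReal.ofReal_le_ofReal (by norm_num)).trans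
        (one_half_le_minimaxProb_contamination hd hs hpos h1)).trans (minimaxProb_anti ?_)
      calc _ ≤ 1 / 16 * ε ^ 2 := by
            gcongr
            exact min_le_right _ _
        _ = _ := by ring
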